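/- Let $(M,g)$ be a connected, finite-dimensional smooth Riemannian manifold (without boundary) with Riemannian distance $d$ and Levi-Civita connection $\nabla$. Let $F$ be a complete smooth vector field on $M$ with flow $\varphi_t$, and suppose there is a constant $L>0$ such that $\|\nabla F\|_g\le L$, i.e. at every point $x\in M$ the linear map $T_xM\to T_xM$, $v\mapsto\nabla_vF$, has operator norm at most $L$ with respect to $g$. Let $\psi_h:M\to M$ be a numerical one-step method with step size $h>0$ whose local error satisfies, for some $p\in\mathbb N$ and some constant $C$, $$d(\psi_h(u),\varphi_h(u))\le C\,h^{p+1}\quad\text{for all }u\in M.$$ Let $u^0\in M$, let $u(t)=\varphi_t(u^0)$ be the exact solution of $\dot u=F(u)$, $u(0)=u^0$, and let $u^{k+1}=\psi_h(u^k)$ for $k\ge 0$ be the numerical solution. Then the global error satisfies $$d\bigl(u(kh),u^k\bigr)\le\frac{C}{L}\bigl(e^{khL}-1\bigr)h^p\quad\text{for all integers }k>0.$$ -/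

import Mathlib

open Bundle Manifold Set Filter Topology
open scoped ContDiff

noncomputable section
namespace RiemannianError

section LeviCivita

variable {E : Type*} [NormedAddCommGroup E] [NormedSpace ℝ E] [FiniteDimensional ℝ E]
  {H : Type*} [TopologicalSpace H] {I : ModelWithCorners ℝ E H}
  {M : Type*} [TopologicalSpace M] [ChartedSpace H M] [IsManifold I ∞ M]
  [RiemannianBundle (fun x : M ↦ TangentSpace I x)]

variable (I) in
/-- The right-hand side of the Koszul formula, which is `2 g(∇_X Y, Z)` at the point `x`:
`X g(Y, Z) + Y g(X, Z) - Z g(X, Y) + g([X, Y], Z) - g([X, Z], Y) - g([Y, Z], X)`. -/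
def koszul (X Y Z : Π x : M, TangentSpace I x) (x : M) : ℝ :=
  d% (fun y ↦ inner ℝ (Y y) (Z y)) x (X x)
    + d% (fun y ↦ inner ℝ (X y) (Z y)) x (Y x)
    - d% (fun y ↦ inner ℝ (X y) (Y y)) x (Z x)
    + inner ℝ (VectorField.mlieBracket I X Y x) (Z x)
    - inner ℝ (VectorField.mlieBracket I X Z x) (Y x)
    - inner ℝ (VectorField.mlieBracket I Y Z x) (X x)

variable [IsContMDiffRiemannianBundle I ∞ E (fun x : M ↦ TangentSpace I x)]

lemma mdiff_inner {X Y : Π x : M, TangentSpace I x} {x : M} (hX : MDiffAt (T% X) x)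
    (hY : MDiffAt (T% Y) x) : MDiffAt (fun y ↦ inner ℝ (X y) (Y y)) x :=
  MDifferentiableAt.inner_bundle (IB := I) (F := E) (E := fun x : M ↦ TangentSpace I x) (b := id)
    (v := X) (w := Y) hX hY

lemma koszul_tensorial_right {X Y : Π x : M, TangentSpace I x} {x : M}
    (hX : MDiffAt (T% X) x) (hY : MDiffAt (T% Y) x) :
    TensorialAt I E (fun Z ↦ koszul I X Y Z x) x where
  smul {f Z} hf hZ := by
    have : CompleteSpace E := FiniteDimensional.complete ℝ E
    have h1 := mvfderiv_mul hf (mdiff_inner hX hZ)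
    have h2 := mvfderiv_mul hf (mdiff_inner hY hZ)
    have e1 : (fun y ↦ inner ℝ (X y) ((f • Z) y)) = f * fun y ↦ inner ℝ (X y) (Z y) := by
      ext y; simp [inner_smul_right]
    have e2 : (fun y ↦ inner ℝ (Y y) ((f • Z) y)) = f * fun y ↦ inner ℝ (Y y) (Z y) := by
      ext y; simp [inner_smul_right]
    simp only [koszul, e1, e2, h1, h2, VectorField.mlieBracket_smul_right hf hZ]
    simp [inner_smul_right, inner_smul_left, inner_add_left]
    simp only [real_inner_comm]
    ring
  add {Z Z'} hZ hZ' := by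
    have : CompleteSpace E := FiniteDimensional.complete ℝ E
    have h1 := mvfderiv_add (mdiff_inner hX hZ) (mdiff_inner hX hZ')
    have h2 := mvfderiv_add (mdiff_inner hY hZ) (mdiff_inner hY hZ')
    have e1 : (fun y ↦ inner ℝ (X y) ((Z + Z') y)) =
        (fun y ↦ inner ℝ (X y) (Z y)) + fun y ↦ inner ℝ (X y) (Z' y) := by
      ext y; simp [inner_add_right]
    have e2 : (fun y ↦ inner ℝ (Y y) ((Z + Z') y)) =
        (fun y ↦ inner ℝ (Y y) (Z y)) + fun y ↦ inner ℝ (Y y) (Z' y) := by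
      ext y; simp [inner_add_right]
    simp only [koszul, e1, e2, h1, h2, VectorField.mlieBracket_add_right hZ hZ']
    simp [inner_add_left, inner_add_right]
    ring


lemma koszul_tensorial_left {Y Z : Π x : M, TangentSpace I x} {x : M}
    (hY : MDiffAt (T% Y) x) (hZ : MDiffAt (T% Z) x) :
    TensorialAt I E (fun X ↦ koszul I X Y Z x) x where
  smul {f X} hf hX := by
    have : CompleteSpace E := FiniteDimensional.complete ℝ E
    have h1 := mvfderiv_mul hf (mdiff_inner hX hZ)
    have h2 := mvfderiv_mul hf (mdiff_inner hX hY)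
    have e1 : (fun y ↦ inner ℝ ((f • X) y) (Z y)) = f * fun y ↦ inner ℝ (X y) (Z y) := by
      ext y; simp [inner_smul_left]
    have e2 : (fun y ↦ inner ℝ ((f • X) y) (Y y)) = f * fun y ↦ inner ℝ (X y) (Y y) := by
      ext y; simp [inner_smul_left]
    simp only [koszul, e1, e2, h1, h2, VectorField.mlieBracket_smul_left hf hX]
    simp [inner_smul_right, inner_smul_left, inner_add_left]
    ring
  add {X X'} hX hX' := by
    have : CompleteSpace E := FiniteDimensional.complete ℝ E
    have h1 := mvfderiv_add (mdiff_inner hX hZ) (mdiff_inner hX' hZ)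
    have h2 := mvfderiv_add (mdiff_inner hX hY) (mdiff_inner hX' hY)
    have e1 : (fun y ↦ inner ℝ ((X + X') y) (Z y)) =
        (fun y ↦ inner ℝ (X y) (Z y)) + fun y ↦ inner ℝ (X' y) (Z y) := by
      ext y; simp [inner_add_left]
    have e2 : (fun y ↦ inner ℝ ((X + X') y) (Y y)) =
        (fun y ↦ inner ℝ (X y) (Y y)) + fun y ↦ inner ℝ (X' y) (Y y) := by
      ext y; simp [inner_add_left]
    simp only [koszul, e1, e2, h1, h2, VectorField.mlieBracket_add_left hX hX']
    simp [inner_add_left, inner_add_right]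
    ring

lemma koszul_add {X Y Y' Z : Π x : M, TangentSpace I x} {x : M} (hX : MDiffAt (T% X) x)
    (hY : MDiffAt (T% Y) x) (hY' : MDiffAt (T% Y') x) (hZ : MDiffAt (T% Z) x) :
    koszul I X (Y + Y') Z x = koszul I X Y Z x + koszul I X Y' Z x := by
  have : CompleteSpace E := FiniteDimensional.complete ℝ E
  have h1 := mvfderiv_add (mdiff_inner hY hZ) (mdiff_inner hY' hZ)
  have h2 := mvfderiv_add (mdiff_inner hX hY) (mdiff_inner hX hY')
  have e1 : (fun y ↦ inner ℝ ((Y + Y') y) (Z y)) =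
      (fun y ↦ inner ℝ (Y y) (Z y)) + fun y ↦ inner ℝ (Y' y) (Z y) := by
    ext y; simp [inner_add_left]
  have e2 : (fun y ↦ inner ℝ (X y) ((Y + Y') y)) =
      (fun y ↦ inner ℝ (X y) (Y y)) + fun y ↦ inner ℝ (X y) (Y' y) := by
    ext y; simp [inner_add_right]
  simp only [koszul, e1, e2, h1, h2, VectorField.mlieBracket_add_right hY hY',
    VectorField.mlieBracket_add_left hY hY']
  simp [inner_add_left, inner_add_right]
  ring

lemma koszul_smul {f : M → ℝ} {X Y Z : Π x : M, TangentSpace I x} {x : M} (hf : MDiffAt f x)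
    (hX : MDiffAt (T% X) x) (hY : MDiffAt (T% Y) x) (hZ : MDiffAt (T% Z) x) :
    koszul I X (f • Y) Z x =
      f x * koszul I X Y Z x + 2 * (d% f x (X x) * inner ℝ (Y x) (Z x)) := by
  have : CompleteSpace E := FiniteDimensional.complete ℝ E
  have h1 := mvfderiv_mul hf (mdiff_inner hY hZ)
  have h2 := mvfderiv_mul hf (mdiff_inner hX hY)
  have e1 : (fun y ↦ inner ℝ ((f • Y) y) (Z y)) = f * fun y ↦ inner ℝ (Y y) (Z y) := by
    ext y; simp [inner_smul_left]
  have e2 : (fun y ↦ inner ℝ (X y) ((f • Y) y)) = f * fun y ↦ inner ℝ (X y) (Y y) := by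
    ext y; simp [inner_smul_right]
  simp only [koszul, e1, e2, h1, h2, VectorField.mlieBracket_smul_right hf hY,
    VectorField.mlieBracket_smul_left hf hY]
  simp [inner_smul_right, inner_smul_left, inner_add_left]
  simp only [real_inner_comm]
  ring

variable (I) in
lemma koszul_torsion (X Y Z : Π x : M, TangentSpace I x) (x : M) :
    koszul I X Y Z x - koszul I Y X Z x =
      2 * inner ℝ (VectorField.mlieBracket I X Y x) (Z x) := by
  have e : (fun y ↦ inner ℝ (Y y) (X y)) = fun y ↦ inner ℝ (X y) (Y y) := by
    ext y; exact real_inner_comm _ _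
  simp only [koszul, e, VectorField.mlieBracket_swap_apply (V := Y) (W := X), inner_neg_left]
  ring

variable (I) in
lemma koszul_metric (X Y Z : Π x : M, TangentSpace I x) (x : M) :
    koszul I X Y Z x + koszul I X Z Y x = 2 * d% (fun y ↦ inner ℝ (Y y) (Z y)) x (X x) := by
  have e : (fun y ↦ inner ℝ (Z y) (Y y)) = fun y ↦ inner ℝ (Y y) (Z y) := by
    ext y; exact real_inner_comm _ _
  simp only [koszul, e, VectorField.mlieBracket_swap_apply (V := Z) (W := Y), inner_neg_left]
  ring

/-- For `Y` differentiable at `x`, the Koszul expression depends on `X` and `Z` only through their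
values at `x`, and defines the bilinear form `(v, w) ↦ 2 g(∇_v Y, w)` on the tangent space. -/
def koszulForm (Y : Π x : M, TangentSpace I x) (x : M) (hY : MDiffAt (T% Y) x) :
    TangentSpace I x →L[ℝ] TangentSpace I x →L[ℝ] ℝ :=
  TensorialAt.mkHom₂ (fun X Z ↦ koszul I X Y Z x) x
    (fun _ hZ ↦ koszul_tensorial_left hY hZ) (fun _ hX ↦ koszul_tensorial_right hX hY)

lemma koszulForm_apply {X Y Z : Π x : M, TangentSpace I x} {x : M} (hX : MDiffAt (T% X) x)
    (hY : MDiffAt (T% Y) x) (hZ : MDiffAt (T% Z) x) :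
    koszulForm Y x hY (X x) (Z x) = koszul I X Y Z x :=
  TensorialAt.mkHom₂_apply _ _ hX hZ

instance finiteDimensional_tangentSpace (x : M) : FiniteDimensional ℝ (TangentSpace I x) :=
  inferInstanceAs (FiniteDimensional ℝ E)

open Classical in
/-- `leviCivitaFun Y x v` is `∇_v Y`: the vector with `2 g(∇_v Y, w)` equal to the Koszul form. By
convention it is `0` if `Y` is not differentiable at `x`. -/
def leviCivitaFun (Y : Π x : M, TangentSpace I x) (x : M) :
    TangentSpace I x →L[ℝ] TangentSpace I x :=
  if hY : MDiffAt (T% Y) x then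
    haveI : CompleteSpace (TangentSpace I x) := FiniteDimensional.complete ℝ _
    LinearMap.toContinuousLinearMap
      { toFun v := (1 / 2 : ℝ) • (InnerProductSpace.toDual ℝ (TangentSpace I x)).symm
          (koszulForm Y x hY v)
        map_add' v w := by simp
        map_smul' c v := by simp [smul_comm c] }
  else 0

/-- The Koszul formula. -/
lemma inner_leviCivitaFun {X Y Z : Π x : M, TangentSpace I x} {x : M} (hX : MDiffAt (T% X) x)
    (hY : MDiffAt (T% Y) x) (hZ : MDiffAt (T% Z) x) :
    2 * inner ℝ (leviCivitaFun Y x (X x)) (Z x) = koszul I X Y Z x := by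
  have : CompleteSpace (TangentSpace I x) := FiniteDimensional.complete ℝ _
  rw [← koszulForm_apply hX hY hZ, leviCivitaFun, dif_pos hY]
  simp [inner_smul_left]

lemma leviCivitaFun_ext {x : M} {A B : TangentSpace I x →L[ℝ] TangentSpace I x}
    (h : ∀ X Z : Π x : M, TangentSpace I x, MDiffAt (T% X) x → MDiffAt (T% Z) x →
      2 * inner ℝ (A (X x)) (Z x) = 2 * inner ℝ (B (X x)) (Z x)) : A = B := by
  ext v
  refine ext_inner_right ℝ fun w ↦ ?_
  have := h (FiberBundle.extend E v) (FiberBundle.extend E w)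
    (FiberBundle.mdifferentiableAt_extend ..) (FiberBundle.mdifferentiableAt_extend ..)
  simpa using this

variable (I M) in
/-- The Levi-Civita connection of a Riemannian manifold; `leviCivita I M Y x v` is `∇_v Y`, so that
`leviCivita I M Y x` is the endomorphism `v ↦ ∇_v Y` of the tangent space at `x`. -/
def leviCivita : CovariantDerivative I E (fun x : M ↦ TangentSpace I x) where
  toFun := leviCivitaFun
  isCovariantDerivativeOnUniv :=
    { add := fun {Y Y' x} hY hY' _ ↦ leviCivitaFun_ext fun X Z hX hZ ↦ by
        have hs : MDiffAt (T% (Y + Y')) x := mdifferentiableAt_add_section hY hY'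
        rw [inner_leviCivitaFun hX hs hZ, koszul_add hX hY hY' hZ, add_apply,
          inner_add_left, mul_add, inner_leviCivitaFun hX hY hZ, inner_leviCivitaFun hX hY' hZ]
      leibniz := fun {Y f x} hY hf _ ↦ leviCivitaFun_ext fun X Z hX hZ ↦ by
        have hs : MDiffAt (T% (f • Y)) x := hf.smul_section hY
        rw [inner_leviCivitaFun hX hs hZ, koszul_smul hf hX hY hZ, ← inner_leviCivitaFun hX hY hZ]
        simp [inner_add_left, inner_smul_left]
        ring }

/-- The Levi-Civita connection is torsion-free. -/
theorem leviCivita_torsion [CompleteSpace E] : (leviCivita I M).torsion = 0 := by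
  rw [CovariantDerivative.torsion_eq_zero_iff]
  intro X Y x hX hY
  refine ext_inner_right ℝ fun w ↦ ?_
  have hw : MDiffAt (T% (FiberBundle.extend E w)) x := FiberBundle.mdifferentiableAt_extend ..
  have h1 := inner_leviCivitaFun hX hY hw
  have h2 := inner_leviCivitaFun hY hX hw
  have h3 := koszul_torsion I X Y (FiberBundle.extend E w) x
  rw [← h1, ← h2] at h3
  simp at h3
  rw [inner_sub_left]
  change inner ℝ (leviCivitaFun Y x (X x)) w - inner ℝ (leviCivitaFun X x (Y x)) w = _
  linarith

/-- The Levi-Civita connection is compatible with the metric. -/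
theorem leviCivita_metric {X Y Z : Π x : M, TangentSpace I x} {x : M} (hX : MDiffAt (T% X) x)
    (hY : MDiffAt (T% Y) x) (hZ : MDiffAt (T% Z) x) :
    d% (fun y ↦ inner ℝ (Y y) (Z y)) x (X x) =
      inner ℝ (leviCivita I M Y x (X x)) (Z x) + inner ℝ (Y x) (leviCivita I M Z x (X x)) := by
  have h1 := inner_leviCivitaFun hX hY hZ
  have h2 := inner_leviCivitaFun hX hZ hY
  have h3 := koszul_metric I X Y Z x
  rw [← h1, ← h2, real_inner_comm (Y x)] at h3
  change _ = inner ℝ (leviCivitaFun Y x (X x)) (Z x) + inner ℝ (Y x) (leviCivitaFun Z x (X x))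
  linarith

end LeviCivita

section Flow

variable {E : Type*} [NormedAddCommGroup E] [NormedSpace ℝ E]
  {H : Type*} [TopologicalSpace H] {I : ModelWithCorners ℝ E H}
  {M : Type*} [TopologicalSpace M] [ChartedSpace H M]

/-- A vector field is complete if through every point there is an integral curve defined for all
real times. -/
def IsCompleteVectorField (F : Π x : M, TangentSpace I x) : Prop :=
  ∀ x : M, ∃ γ : ℝ → M, γ 0 = x ∧ IsMIntegralCurve γ F

/-- The flow of a complete vector field: `t ↦ flow hF t x` is the integral curve of `F` which is
at `x` at time `0`. It is unique when `F` is smooth and `M` is Hausdorff without boundary. -/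
def flow {F : Π x : M, TangentSpace I x} (hF : IsCompleteVectorField F) (t : ℝ) (x : M) : M :=
  (hF x).choose t

variable {F : Π x : M, TangentSpace I x} (hF : IsCompleteVectorField F)

theorem flow_zero (x : M) : flow hF 0 x = x := (hF x).choose_spec.1

theorem isMIntegralCurve_flow (x : M) : IsMIntegralCurve (fun t ↦ flow hF t x) F :=
  (hF x).choose_spec.2

/-- The flow is the only solution of the initial value problem. -/
theorem eq_flow [I.Boundaryless] [T2Space M] [IsManifold I 1 M] [CompleteSpace E]
    (hs : ContMDiff I I.tangent 1 (fun x ↦ (⟨x, F x⟩ : TangentBundle I M)))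
    {γ : ℝ → M} (hγ : IsMIntegralCurve γ F) (t : ℝ) : γ t = flow hF t (γ 0) :=
  congrFun (isMIntegralCurve_Ioo_eq_of_contMDiff_boundaryless (t₀ := 0) hs hγ
    (isMIntegralCurve_flow hF (γ 0)) (flow_zero hF (γ 0)).symm) t

end Flow

end RiemannianError

end

/-!
The square of the length of a tangent vector `v` transported by the flow of `F` changes at the rate
`2⟪∇_v F, v⟫ ≤ 2 L ‖v‖²`, so the flow stretches distances at most by `exp (L t)`. To avoid
differentiating the flow with respect to its initial point, integral curves are compared in a chart
with Euler steps: these are first order accurate, and by the bound on the variation of the metric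
the Euler step of size `s` is locally Lipschitz with constant `1 + K s` whenever `L < K`. Hence the
distance of two nearby integral curves grows at rate at most `K`; Grönwall's inequality makes the
flow locally `exp (K t)`-Lipschitz, and since distances are infima of lengths of paths, it is
globally so. Let `K` tend to `L`.

Comparing `φ_h (u (k h))` with `φ_h (u^k)` and then with `ψ_h (u^k)` gives the recursion
`e (k + 1) ≤ exp (L h) e k + C h ^ (p + 1)` for the global error, which sums to the claimed bound
because `L h ≤ exp (L h) - 1`.
-/

noncomputable section
namespace RiemannianError

-- At the default depth, instance search on `E →L[ℝ] E →L[ℝ] ℝ` times out.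
set_option maxSynthPendingDepth 3

section EulerPullback

variable {E : Type*} [NormedAddCommGroup E] [NormedSpace ℝ E]

lemma eventually_apply_self_le {X : Type*} [TopologicalSpace X] {S T : X → E →L[ℝ] E →L[ℝ] ℝ}
    {x : X} {c : ℝ} (hS : ContinuousAt S x) (hT : ContinuousAt T x) (hc : 0 < c)
    (h : ∀ v, S x v v + c * ‖v‖ ^ 2 ≤ T x v v) : ∀ᶠ y in 𝓝 x, ∀ v, S y v v ≤ T y v v := by
  have hnear : ∀ᶠ y in 𝓝 x, ‖(S y - T y) - (S x - T x)‖ < c := by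
    simpa [dist_eq_norm] using (hS.sub hT).eventually (Metric.ball_mem_nhds _ hc)
  filter_upwards [hnear] with y hy v
  have hdiff : (S y - T y - (S x - T x)) v v ≤ c * ‖v‖ * ‖v‖ :=
    (le_abs_self _).trans <| ContinuousLinearMap.le_of_opNorm₂_le_of_le _ hy.le le_rfl le_rfl
  simp only [sub_apply] at hdiff
  linarith [h v]

lemma continuousAt_bilinearComp {X : Type*} [TopologicalSpace X] {T : X → E →L[ℝ] E →L[ℝ] ℝ}
    {A B : X → E →L[ℝ] E} {x : X} (hT : ContinuousAt T x) (hA : ContinuousAt A x)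
    (hB : ContinuousAt B x) : ContinuousAt (fun y ↦ (T y).bilinearComp (A y) (B y)) x :=
  have hB' : ContinuousAt (fun y ↦ (ContinuousLinearMap.compL ℝ E E ℝ).flip (B y)) x :=
    (ContinuousLinearMap.continuous _).continuousAt.comp hB
  hB'.clm_comp (hT.clm_comp hA)

/-- The derivative in `s` of the pullback of the bilinear forms `G` under the Euler map
`u ↦ u + s • f u`, at `(s, u)`. At `s = 0` it is the Lie derivative of `G` along `f`. -/
def eulerPullbackDeriv (G : E → E →L[ℝ] E →L[ℝ] ℝ) (f : E → E) (p : ℝ × E) :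
    E →L[ℝ] E →L[ℝ] ℝ :=
  let A := .id ℝ E + p.1 • fderiv ℝ f p.2
  (fderiv ℝ G (p.2 + p.1 • f p.2) (f p.2)).bilinearComp A A
    + (G (p.2 + p.1 • f p.2)).bilinearComp (fderiv ℝ f p.2) A
    + (G (p.2 + p.1 • f p.2)).bilinearComp A (fderiv ℝ f p.2)

variable {G : E → E →L[ℝ] E →L[ℝ] ℝ} {f : E → E}

lemma hasDerivAt_eulerPullback {s : ℝ} {u : E} (hG : DifferentiableAt ℝ G (u + s • f u)) (v : E) :
    HasDerivAt (fun s : ℝ ↦ G (u + s • f u) (v + s • fderiv ℝ f u v) (v + s • fderiv ℝ f u v))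
      (eulerPullbackDeriv G f (s, u) v v) s := by
  have hline (a b : E) : HasDerivAt (fun s : ℝ ↦ a + s • b) b s := by
    simpa using ((hasDerivAt_id s).smul_const b).const_add a
  have hv := hline v (fderiv ℝ f u v)
  have hGs := hG.hasFDerivAt.comp_hasDerivAt s (hline u (f u))
  refine ((hGs.clm_apply hv).clm_apply hv).congr_deriv ?_
  simp [eulerPullbackDeriv]

lemma continuousAt_eulerPullbackDeriv {u : E} (hG : ContDiffAt ℝ 1 G u) (hf : ContDiffAt ℝ 1 f u) :
    ContinuousAt (eulerPullbackDeriv G f) (0, u) := by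
  have hf₀ : ContinuousAt (fun p : ℝ × E ↦ f p.2) (0, u) :=
    ContinuousAt.comp (g := f) hf.continuousAt continuousAt_snd
  have hf₁ : ContinuousAt (fun p : ℝ × E ↦ fderiv ℝ f p.2) (0, u) :=
    ContinuousAt.comp (g := fderiv ℝ f) (hf.continuousAt_fderiv one_ne_zero) continuousAt_snd
  have hstep : Tendsto (fun p : ℝ × E ↦ p.2 + p.1 • f p.2) (𝓝 (0, u)) (𝓝 u) := by
    simpa using! (continuousAt_snd.add (continuousAt_fst.smul hf₀)).tendsto
  have hA : ContinuousAt (fun p : ℝ × E ↦ .id ℝ E + p.1 • fderiv ℝ f p.2) (0, u) :=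
    continuousAt_const.add (continuousAt_fst.smul hf₁)
  have hG₀ : ContinuousAt (fun p : ℝ × E ↦ G (p.2 + p.1 • f p.2)) (0, u) := by
    simpa [ContinuousAt] using! hG.continuousAt.tendsto.comp hstep
  have hG₁ : ContinuousAt (fun p : ℝ × E ↦ fderiv ℝ G (p.2 + p.1 • f p.2)) (0, u) := by
    simpa [ContinuousAt] using! (hG.continuousAt_fderiv one_ne_zero).tendsto.comp hstep
  exact ((continuousAt_bilinearComp (hG₁.clm_apply hf₀) hA hA).add
    (continuousAt_bilinearComp hG₀ hf₁ hA)).add (continuousAt_bilinearComp hG₀ hA hf₁)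

lemma eventually_forall_Icc_zero_of_eventually {X : Type*} [PseudoMetricSpace X] {x : X}
    {q : ℝ × X → Prop} (h : ∀ᶠ p in 𝓝 (0, x), q p) :
    ∀ᶠ p : ℝ × X in 𝓝 (0, x), ∀ s ∈ Icc 0 p.1, q (s, p.2) := by
  obtain ⟨r, hr, hball⟩ := Metric.eventually_nhds_iff_ball.1 h
  filter_upwards [Metric.ball_mem_nhds _ hr] with p hp s hs
  simp only [Metric.mem_ball, Prod.dist_eq, max_lt_iff, dist_zero_right, Real.norm_eq_abs] at hp
  refine hball _ ?_
  simp only [Metric.mem_ball, Prod.dist_eq, max_lt_iff, dist_zero_right, Real.norm_eq_abs]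
  exact ⟨(abs_le_abs_of_nonneg hs.1 hs.2).trans_lt hp.1, hp.2⟩

lemma eventually_eulerPullback_le {u₀ : E} (hG : ContDiffAt ℝ 1 G u₀) (hf : ContDiffAt ℝ 1 f u₀)
    {c : ℝ} (hc : 0 < c) (hpos : ∀ v, c * ‖v‖ ^ 2 ≤ G u₀ v v) {K K' : ℝ} (hK : K < K')
    (hLie : ∀ v, fderiv ℝ G u₀ (f u₀) v v + G u₀ (fderiv ℝ f u₀ v) v + G u₀ v (fderiv ℝ f u₀ v) ≤
      K * G u₀ v v) :
    ∀ᶠ p : ℝ × E in 𝓝 (0, u₀), 0 ≤ p.1 → ∀ v,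
      G (p.2 + p.1 • f p.2) (v + p.1 • fderiv ℝ f p.2 v) (v + p.1 • fderiv ℝ f p.2 v) ≤
        (1 + K' * p.1) * G p.2 v v := by
  have hG' : ∀ᶠ p : ℝ × E in 𝓝 (0, u₀), DifferentiableAt ℝ G (p.2 + p.1 • f p.2) := by
    have hstep : ContinuousAt (fun p : ℝ × E ↦ p.2 + p.1 • f p.2) (0, u₀) :=
      continuousAt_snd.add <| continuousAt_fst.smul <|
        ContinuousAt.comp (g := f) hf.continuousAt continuousAt_snd
    refine hstep.eventually (p := DifferentiableAt ℝ G) ?_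
    simpa using (hG.eventually (by simp)).mono fun u hu ↦ hu.differentiableAt one_ne_zero
  have hderiv : ∀ᶠ p : ℝ × E in 𝓝 (0, u₀), ∀ v,
      eulerPullbackDeriv G f p v v ≤ (K' • G p.2) v v := by
    refine eventually_apply_self_le (continuousAt_eulerPullbackDeriv hG hf)
      ((ContinuousAt.comp (g := G) hG.continuousAt continuousAt_snd).const_smul K')
      (mul_pos (sub_pos.2 hK) hc) fun v ↦ ?_
    have hgap := mul_le_mul_of_nonneg_left (hpos v) (sub_pos.2 hK).le
    have hLie₀ : eulerPullbackDeriv G f (0, u₀) v v ≤ K * G u₀ v v := by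
      simpa [eulerPullbackDeriv] using hLie v
    change _ ≤ K' * G u₀ v v
    linarith
  filter_upwards [eventually_forall_Icc_zero_of_eventually (hG'.and hderiv)] with ⟨s, u⟩ hs hs₀ v
  have hd (t : ℝ) (ht : t ∈ Icc 0 s) := hasDerivAt_eulerPullback (hs t ht).1 v
  have hmvt := (convex_Icc 0 s).image_sub_le_mul_sub_of_deriv_le
    (fun t ht ↦ (hd t ht).continuousAt.continuousWithinAt)
    (fun t ht ↦ (hd t (interior_subset ht)).differentiableAt.differentiableWithinAt)
    (fun t ht ↦ (hd t (interior_subset ht)).deriv.trans_le ((hs t (interior_subset ht)).2 v))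
    0 (left_mem_Icc.2 hs₀) s (right_mem_Icc.2 hs₀) hs₀
  simp only [zero_smul, add_zero, sub_zero, smul_apply, smul_eq_mul] at hmvt ⊢
  linarith

end EulerPullback

section Length

open MeasureTheory
open scoped NNReal ENNReal

lemma edist_add_le_of_forall_eventually_nhdsGT {X : Type*} [PseudoEMetricSpace X] {g : ℝ → X}
    {ℓ : ℝ → ℝ≥0∞} {a b : ℝ} (hab : a ≤ b) (hg : ContinuousOn g (Icc a b))
    (hℓ : MonotoneOn ℓ (Icc a b))
    (h : ∀ t ∈ Ico a b, ∀ᶠ s in 𝓝[>] t, edist (g t) (g s) + ℓ t ≤ ℓ s) :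
    edist (g a) (g b) + ℓ a ≤ ℓ b := by
  set S := {t ∈ Icc a b | edist (g a) (g t) + ℓ a ≤ ℓ t}
  have haS : a ∈ S := ⟨left_mem_Icc.2 hab, by simp⟩
  have hSb : BddAbove S := ⟨b, fun t ht ↦ ht.1.2⟩
  set c := sSup S
  have hac : a ≤ c := le_csSup hSb haS
  have hcb : c ≤ b := csSup_le ⟨a, haS⟩ fun t ht ↦ ht.1.2
  have hcS : c ∈ S := by
    have hclosed : IsClosed {t ∈ Icc a b | edist (g a) (g t) + ℓ a ≤ ℓ c} :=
      ((continuous_edist.comp_continuousOn (continuousOn_const.prodMk hg)).add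
        continuousOn_const).preimage_isClosed_of_isClosed isClosed_Icc isClosed_Iic
    refine ⟨⟨hac, hcb⟩, (closure_minimal (fun t ht ↦ ?_) hclosed
      (csSup_mem_closure ⟨a, haS⟩ hSb)).2⟩
    exact ⟨ht.1, ht.2.trans (hℓ ht.1 ⟨hac, hcb⟩ (le_csSup hSb ht))⟩
  rcases hcb.eq_or_lt with hcb | hcb
  · exact hcb ▸ hcS.2
  obtain ⟨s, hs, hcs, hsb⟩ := ((h c ⟨hac, hcb⟩).and (Ioo_mem_nhdsGT hcb)).exists
  have hsS : s ∈ S := by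
    refine ⟨⟨hac.trans hcs.le, hsb.le⟩, ?_⟩
    calc edist (g a) (g s) + ℓ a
        ≤ edist (g c) (g s) + (edist (g a) (g c) + ℓ a) := by
          rw [← add_assoc, add_comm (edist (g c) _)]
          gcongr
          exact edist_triangle ..
      _ ≤ edist (g c) (g s) + ℓ c := by gcongr; exact hcS.2
      _ ≤ ℓ s := hs
  exact absurd (le_csSup hSb hsS) hcs.not_ge

variable {E : Type*} [NormedAddCommGroup E] [NormedSpace ℝ E]
  {H : Type*} [TopologicalSpace H] {I : ModelWithCorners ℝ E H}
  {E' : Type*} [NormedAddCommGroup E'] [NormedSpace ℝ E']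
  {H' : Type*} [TopologicalSpace H'] {I' : ModelWithCorners ℝ E' H'}

lemma pathELength_comp_le {M : Type*} [TopologicalSpace M] [ChartedSpace H M]
    {M' : Type*} [TopologicalSpace M'] [ChartedSpace H' M']
    [∀ x : M, ENorm (TangentSpace I x)] [∀ x : M', ENorm (TangentSpace I' x)]
    {Φ : M → M'} {γ : ℝ → M} {a b : ℝ} {Λ : ℝ≥0}
    (hΦ : ∀ t ∈ Ioo a b, MDifferentiableAt I I' Φ (γ t))
    (hγ : ∀ t ∈ Ioo a b, MDifferentiableAt 𝓘(ℝ, ℝ) I γ t)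
    (hΛ : ∀ t ∈ Ioo a b, ∀ v, ‖mfderiv I I' Φ (γ t) v‖ₑ ≤ Λ * ‖v‖ₑ) :
    pathELength I' (Φ ∘ γ) a b ≤ Λ * pathELength I γ a b := by
  rw [pathELength_eq_lintegral_mfderiv_Ioo, pathELength_eq_lintegral_mfderiv_Ioo,
    ← lintegral_const_mul' _ _ ENNReal.coe_ne_top]
  refine setLIntegral_mono' measurableSet_Ioo fun t ht ↦ ?_
  rw [mfderiv_comp t (hΦ t ht) (hγ t ht)]
  exact hΛ t ht _

section PseudoEMetric

variable {M : Type*} [PseudoEMetricSpace M] [ChartedSpace H M]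
  [RiemannianBundle (fun x : M ↦ TangentSpace I x)] [IsRiemannianManifold I M]

lemma edist_le_pathELength {γ : ℝ → M} {a b : ℝ} (hγ : ContMDiffOn 𝓘(ℝ, ℝ) I 1 γ (Icc a b))
    (hab : a ≤ b) : edist (γ a) (γ b) ≤ pathELength I γ a b := by
  rw [IsRiemannianManifold.out (I := I) (γ a) (γ b)]
  exact riemannianEDist_le_pathELength hγ rfl rfl hab

variable (I) in
lemma edist_le_mul_edist_of_forall_path {X : Type*} [PseudoEMetricSpace X] {f : M → X} {x y : M}
    {Λ : ℝ≥0} {R : ℝ≥0∞} (hxy : edist x y < R)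
    (h : ∀ γ : ℝ → M, γ 0 = x → γ 1 = y → ContMDiff 𝓘(ℝ, ℝ) I 1 γ → pathELength I γ 0 1 < R →
      edist (f x) (f y) ≤ Λ * pathELength I γ 0 1) :
    edist (f x) (f y) ≤ Λ * edist x y := by
  have : (𝓝[>] edist x y).NeBot := nhdsGT_neBot_of_exists_gt ⟨R, hxy⟩
  have hlim : Tendsto (fun r : ℝ≥0∞ ↦ Λ * r) (𝓝[>] edist x y) (𝓝 (Λ * edist x y)) :=
    ((ENNReal.continuous_const_mul ENNReal.coe_ne_top).tendsto _).mono_left nhdsWithin_le_nhds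
  refine ge_of_tendsto hlim ?_
  filter_upwards [Ioo_mem_nhdsGT hxy] with r hr
  obtain ⟨γ, h0, h1, hγ, hlen, -⟩ := exists_lt_locally_constant_of_riemannianEDist_lt
    ((IsRiemannianManifold.out (I := I) x y).symm.trans_lt hr.1) zero_lt_one
  exact (h γ h0 h1 hγ (hlen.trans hr.2)).trans (by gcongr)

lemma lipschitzOnWith_of_enorm_mfderiv_le {Φ : E' → M} {s : Set E'} {Λ : ℝ≥0}
    (hs : Convex ℝ s) (hΦ : ∀ u ∈ s, ContMDiffAt 𝓘(ℝ, E') I 1 Φ u)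
    (hΛ : ∀ u ∈ s, ∀ v : E', ‖(mfderiv 𝓘(ℝ, E') I Φ u v : TangentSpace I (Φ u))‖ₑ ≤ Λ * ‖v‖ₑ) :
    LipschitzOnWith Λ Φ s := by
  intro u hu u' hu'
  set c : ℝ → E' := fun t ↦ u + t • (u' - u)
  have hc (t : ℝ) : HasDerivAt c (u' - u) t := by
    simpa [c] using ((hasDerivAt_id t).smul_const (u' - u)).const_add u
  have hmem {t : ℝ} (ht : t ∈ Icc 0 1) : c t ∈ s := hs.add_smul_sub_mem hu hu' ht
  have hΦc : ContMDiffOn 𝓘(ℝ, ℝ) I 1 (Φ ∘ c) (Icc 0 1) := fun t ht ↦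
    ((hΦ _ (hmem ht)).comp t
      (by fun_prop : ContDiff ℝ 1 c).contMDiff.contMDiffAt).contMDiffWithinAt
  calc edist (Φ u) (Φ u') = edist ((Φ ∘ c) 0) ((Φ ∘ c) 1) := by simp [c]
    _ ≤ ∫⁻ t in Ioo (0 : ℝ) 1, ‖mfderiv 𝓘(ℝ, ℝ) I (Φ ∘ c) t 1‖ₑ := by
        rw [← pathELength_eq_lintegral_mfderiv_Ioo]
        exact edist_le_pathELength hΦc zero_le_one
    _ ≤ ∫⁻ _ in Ioo (0 : ℝ) 1, Λ * edist u u' := by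
        refine setLIntegral_mono' measurableSet_Ioo fun t ht ↦ ?_
        have hd := ((hΦ _ (hmem (Ioo_subset_Icc_self ht))).mdifferentiableAt
          one_ne_zero).hasMFDerivAt.comp t (hc t).hasFDerivAt.hasMFDerivAt
        rw [hd.mfderiv, edist_comm, edist_eq_enorm_sub]
        exact (congrArg (fun v : E' ↦ ‖(mfderiv 𝓘(ℝ, E') I Φ (c t) v : TangentSpace I (Φ (c t)))‖ₑ)
          (one_smul ℝ (u' - u))).trans_le (hΛ _ (hmem (Ioo_subset_Icc_self ht)) (u' - u))
    _ = Λ * edist u u' := by simp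

end PseudoEMetric

theorem lipschitzWith_of_eventually_edist_le (I : ModelWithCorners ℝ E H) {M : Type*}
    [PseudoMetricSpace M] [ChartedSpace H M] [RiemannianBundle (fun x : M ↦ TangentSpace I x)]
    [IsRiemannianManifold I M] {X : Type*} [PseudoEMetricSpace X] {f : M → X}
    {Λ : ℝ≥0} (h : ∀ x, ∀ᶠ y in 𝓝 x, edist (f x) (f y) ≤ Λ * edist x y) :
    LipschitzWith Λ f := by
  have hf : Continuous f := continuous_iff_continuousAt.2 fun x ↦ by
    have hlim : Tendsto (fun y ↦ Λ * edist x y) (𝓝 x) (𝓝 0) :=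
      ((ENNReal.continuous_const_mul ENNReal.coe_ne_top).comp
        (continuous_const.edist continuous_id)).tendsto' _ _ (by simp)
    refine tendsto_iff_edist_tendsto_0.2 (tendsto_of_tendsto_of_tendsto_of_le_of_le'
      tendsto_const_nhds hlim (.of_forall fun _ ↦ zero_le) ?_)
    filter_upwards [h x] with y hy
    rwa [edist_comm]
  intro x y
  refine edist_le_mul_edist_of_forall_path I (edist_lt_top x y) ?_
  rintro γ rfl rfl hγ -
  have hstep (t : ℝ) (ht : t ∈ Ico 0 1) : ∀ᶠ s in 𝓝[>] t, edist (f (γ t)) (f (γ s)) +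
      Λ * pathELength I γ 0 t ≤ Λ * pathELength I γ 0 s := by
    filter_upwards [(hγ.continuous.tendsto t).eventually (h (γ t)) |>.filter_mono
      nhdsWithin_le_nhds, self_mem_nhdsWithin] with s hs hts
    rw [← pathELength_add ht.1 (mem_Ioi.1 hts).le, mul_add, add_comm]
    gcongr
    exact hs.trans (by gcongr; exact edist_le_pathELength hγ.contMDiffOn (mem_Ioi.1 hts).le)
  simpa using edist_add_le_of_forall_eventually_nhdsGT zero_le_one
    (hf.comp hγ.continuous).continuousOn
    (fun s _ t _ hst ↦ mul_right_mono (pathELength_mono le_rfl hst)) hstep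

lemma lipschitzOnWith_ball_of_enorm_mfderiv_le {M : Type*} [PseudoMetricSpace M]
    [ChartedSpace H M] [RiemannianBundle (fun x : M ↦ TangentSpace I x)]
    [IsRiemannianManifold I M] {M' : Type*} [PseudoEMetricSpace M']
    [ChartedSpace H' M'] [RiemannianBundle (fun x : M' ↦ TangentSpace I' x)]
    [IsRiemannianManifold I' M'] {Φ : M → M'} {z : M} {δ : ℝ} {Λ : ℝ≥0}
    (hΦ : ∀ x ∈ Metric.ball z (3 * δ), ContMDiffAt I I' 1 Φ x)
    (hΛ : ∀ x ∈ Metric.ball z (3 * δ), ∀ v, ‖mfderiv I I' Φ x v‖ₑ ≤ Λ * ‖v‖ₑ) :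
    LipschitzOnWith Λ Φ (Metric.ball z δ) := by
  intro x hx y hy
  rw [Metric.mem_ball] at hx hy
  have hxy : edist x y < ENNReal.ofReal (2 * δ) := by
    rw [edist_dist]
    exact (ENNReal.ofReal_lt_ofReal_iff_of_nonneg dist_nonneg).2
      (by linarith [dist_triangle_right x y z])
  refine edist_le_mul_edist_of_forall_path I hxy ?_
  rintro γ rfl rfl hγ hlen
  have hball {t : ℝ} (ht : t ∈ Icc 0 1) : γ t ∈ Metric.ball z (3 * δ) := by
    have hlt : edist (γ 0) (γ t) < ENNReal.ofReal (2 * δ) :=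
      ((edist_le_pathELength (I := I) hγ.contMDiffOn ht.1).trans
        (pathELength_mono le_rfl ht.2)).trans_lt hlen
    rw [edist_dist, ENNReal.ofReal_lt_ofReal_iff_of_nonneg dist_nonneg] at hlt
    rw [Metric.mem_ball]
    linarith [dist_triangle_left (γ t) z (γ 0)]
  calc edist (Φ (γ 0)) (Φ (γ 1)) ≤ pathELength I' (Φ ∘ γ) 0 1 :=
        edist_le_pathELength (γ := Φ ∘ γ) (fun t ht ↦
          ((hΦ _ (hball ht)).comp t hγ.contMDiffAt).contMDiffWithinAt) zero_le_one
    _ ≤ Λ * pathELength I γ 0 1 :=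
        pathELength_comp_le
          (fun t ht ↦ (hΦ _ (hball (Ioo_subset_Icc_self ht))).mdifferentiableAt one_ne_zero)
          (fun t _ ↦ hγ.mdifferentiableAt one_ne_zero)
          fun t ht ↦ hΛ _ (hball (Ioo_subset_Icc_self ht))

end Length

section Gronwall

lemma le_mul_exp_of_liminf_slope_le {d : ℝ → ℝ} {T K K' δ : ℝ} (hK : K < K')
    (hd : ContinuousOn d (Icc 0 T)) (hd0 : 0 < d 0)
    (hs : ∀ t ∈ Ico 0 T, d t < δ → ∀ r, K * d t < r → ∃ᶠ s in 𝓝[>] t, slope d t s < r)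
    (hδ : ∀ t ∈ Icc 0 T, d 0 * Real.exp (K' * t) < δ) :
    ∀ t ∈ Icc 0 T, d t ≤ d 0 * Real.exp (K' * t) := by
  have hB (t : ℝ) : HasDerivAt (fun t ↦ d 0 * Real.exp (K' * t))
      (K' * (d 0 * Real.exp (K' * t))) t := by
    refine ((((hasDerivAt_id' t).const_mul K').exp.const_mul (d 0))).congr_deriv ?_
    ring
  -- The growth of `d` is only controlled below the level `δ`, so `d` is truncated there.
  have hmin : ∀ ⦃t⦄, t ∈ Icc 0 T → min (d t) δ ≤ d 0 * Real.exp (K' * t) := by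
    refine image_le_of_liminf_slope_right_lt_deriv_boundary'
      (f' := fun t ↦ if d t < δ then K * d t else 0) (hd.inf continuousOn_const) ?_ (by simp)
      (fun t _ ↦ (hB t).continuousAt.continuousWithinAt) (fun t _ ↦ (hB t).hasDerivWithinAt) ?_
    · intro t ht r hr
      by_cases hdt : d t < δ
      · rw [if_pos hdt] at hr
        refine ((hs t ht hdt r hr).and_eventually self_mem_nhdsWithin).mono fun s ⟨hsr, hts⟩ ↦ ?_
        refine lt_of_le_of_lt ?_ hsr
        rw [slope_def_field, slope_def_field, min_eq_left hdt.le]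
        have : 0 ≤ s - t := sub_nonneg.2 (le_of_lt hts)
        gcongr
        exact min_le_left _ _
      · rw [if_neg hdt] at hr
        refine Eventually.frequently (eventually_mem_nhdsWithin.mono fun s hts ↦ ?_)
        refine lt_of_le_of_lt ?_ hr
        rw [slope_def_field, min_eq_right (not_lt.1 hdt)]
        exact div_nonpos_of_nonpos_of_nonneg (sub_nonpos.2 (min_le_right _ _))
          (sub_nonneg.2 (mem_Ioi.1 hts).le)
    · intro t ht hmin_eq
      have hdt : d t < δ := by
        by_contra! h
        exact (hδ t (Ico_subset_Icc_self ht)).ne (by rw [← hmin_eq, min_eq_right h])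
      rw [min_eq_left hdt.le] at hmin_eq
      rw [if_pos hdt, hmin_eq]
      gcongr
  intro t ht
  exact (min_le_iff.1 (hmin ht)).resolve_right (hδ t ht).not_ge

end Gronwall

section ErrorRecursion

lemma le_of_forall_succ_le_exp_mul_add {e : ℕ → ℝ} {C L h : ℝ} {p : ℕ} (hC : 0 ≤ C) (hL : 0 < L)
    (hh : 0 ≤ h) (h0 : e 0 ≤ 0)
    (hs : ∀ k, e (k + 1) ≤ Real.exp (L * h) * e k + C * h ^ (p + 1)) (k : ℕ) :
    e k ≤ C / L * (Real.exp (k * h * L) - 1) * h ^ p := by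
  induction k with
  | zero => simp [h0]
  | succ k ih =>
    have hexp : Real.exp ((k + 1 : ℕ) * h * L) = Real.exp (L * h) * Real.exp (k * h * L) := by
      rw [← Real.exp_add]; congr 1; push_cast; ring
    have hone : L * h ≤ Real.exp (L * h) - 1 := by linarith [Real.add_one_le_exp (L * h)]
    have hlocal : C * h ^ (p + 1) ≤ C / L * (Real.exp (L * h) - 1) * h ^ p := by
      calc C * h ^ (p + 1) = C / L * (L * h) * h ^ p := by field_simp; ring
        _ ≤ _ := by gcongr
    calc e (k + 1) ≤ Real.exp (L * h) * e k + C * h ^ (p + 1) := hs k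
      _ ≤ Real.exp (L * h) * (C / L * (Real.exp (k * h * L) - 1) * h ^ p) +
          C / L * (Real.exp (L * h) - 1) * h ^ p := by gcongr
      _ = _ := by rw [hexp]; ring

end ErrorRecursion

lemma flow_add {E : Type*} [NormedAddCommGroup E] [NormedSpace ℝ E] [CompleteSpace E]
    {H : Type*} [TopologicalSpace H] {I : ModelWithCorners ℝ E H} [I.Boundaryless]
    {M : Type*} [TopologicalSpace M] [T2Space M] [ChartedSpace H M] [IsManifold I 1 M]
    {F : Π x : M, TangentSpace I x} (hFc : IsCompleteVectorField F)
    (hF : ContMDiff I I.tangent 1 (T% F)) (s t : ℝ) (x : M) :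
    flow hFc (s + t) x = flow hFc s (flow hFc t x) := by
  simpa using eq_flow hFc hF ((isMIntegralCurve_flow hFc x).comp_add t) s

section Chart

variable {E : Type*} [NormedAddCommGroup E] [NormedSpace ℝ E]
  {H : Type*} [TopologicalSpace H] {I : ModelWithCorners ℝ E H}
  {M : Type*} [TopologicalSpace M] [ChartedSpace H M]

variable (I) in
/-- The derivative at `u` of the inverse of the preferred chart at `z`; on the chart domain it
identifies the model space with the tangent space, without any choice of a metric. -/
def chartSymmDeriv (z : M) (u : E) : E →L[ℝ] TangentSpace I ((extChartAt I z).symm u) :=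
  mfderiv 𝓘(ℝ, E) I (extChartAt I z).symm u

/-- The representation of a vector field in the preferred chart at `z`. It is meaningful on the
target of the chart only. -/
def chartField (z : M) (F : Π x : M, TangentSpace I x) : E → E :=
  VectorField.mpullbackWithin 𝓘(ℝ, E) I (extChartAt I z).symm F (range I)

lemma chartSymmDeriv_eq_mfderivWithin [I.Boundaryless] (z : M) (u : E) :
    chartSymmDeriv I z u = mfderivWithin 𝓘(ℝ, E) I (extChartAt I z).symm (range I) u := by
  rw [I.range_eq_univ, mfderivWithin_univ, chartSymmDeriv]

variable [IsManifold I ∞ M]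

variable (I) in
/-- The local vector field which is constantly `v` in the preferred chart at `z`. -/
def chartConstField (z : M) (v : E) (x : M) : TangentSpace I x :=
  (trivializationAt E (TangentSpace I) z).symm x v

lemma contMDiffOn_chartConstField (z : M) (v : E) :
    ContMDiffOn I (I.prod 𝓘(ℝ, E)) ∞ (T% (chartConstField I z v)) (chartAt H z).source := by
  set e := trivializationAt E (TangentSpace I) z
  intro x hx
  have hxe : x ∈ e.baseSet := by simpa [e] using hx
  refine ((e.contMDiffAt_section_iff hxe).2 ?_).contMDiffWithinAt
  refine (contMDiffAt_const (c := v)).congr_of_eventuallyEq ?_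
  filter_upwards [e.open_baseSet.mem_nhds hxe] with y hy
  simp only [chartConstField]
  rw [e.apply_mk_symm hy]

variable [I.Boundaryless]

variable {z : M} {u : E}

lemma contMDiffAt_extChartAt_symm (hu : u ∈ (extChartAt I z).target) :
    ContMDiffAt 𝓘(ℝ, E) I ∞ (extChartAt I z).symm u :=
  (contMDiffOn_extChartAt_symm z).contMDiffAt ((isOpen_extChartAt_target z).mem_nhds hu)

lemma hasMFDerivAt_extChartAt_symm (hu : u ∈ (extChartAt I z).target) :
    HasMFDerivAt 𝓘(ℝ, E) I (extChartAt I z).symm u (chartSymmDeriv I z u) :=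
  ((contMDiffAt_extChartAt_symm hu).mdifferentiableAt (by simp)).hasMFDerivAt

lemma chartSymmDeriv_comp_mfderiv_extChartAt (hu : u ∈ (extChartAt I z).target) :
    (chartSymmDeriv I z u).comp (mfderiv I 𝓘(ℝ, E) (extChartAt I z) ((extChartAt I z).symm u)) =
      .id ℝ _ := by
  rw [chartSymmDeriv_eq_mfderivWithin]
  exact mfderivWithin_extChartAt_symm_comp_mfderiv_extChartAt hu

lemma mfderiv_extChartAt_comp_chartSymmDeriv (hu : u ∈ (extChartAt I z).target) :
    (mfderiv I 𝓘(ℝ, E) (extChartAt I z) ((extChartAt I z).symm u)).comp (chartSymmDeriv I z u) =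
      .id ℝ _ := by
  rw [chartSymmDeriv_eq_mfderivWithin]
  exact mfderiv_extChartAt_comp_mfderivWithin_extChartAt_symm hu

lemma inverse_mfderiv_extChartAt (hu : u ∈ (extChartAt I z).target) :
    (mfderiv I 𝓘(ℝ, E) (extChartAt I z) ((extChartAt I z).symm u)).inverse =
      chartSymmDeriv I z u := by
  apply ContinuousLinearMap.inverse_eq
  · exact mfderiv_extChartAt_comp_chartSymmDeriv (E := E) hu
  · exact chartSymmDeriv_comp_mfderiv_extChartAt (E := E) hu

lemma chartField_apply (hu : u ∈ (extChartAt I z).target) (F : Π x : M, TangentSpace I x) :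
    chartField z F u = mfderiv I 𝓘(ℝ, E) (extChartAt I z) ((extChartAt I z).symm u)
      (F ((extChartAt I z).symm u)) := by
  rw [chartField, VectorField.mpullbackWithin_apply, ← chartSymmDeriv_eq_mfderivWithin]
  exact congr($(ContinuousLinearMap.inverse_eq (chartSymmDeriv_comp_mfderiv_extChartAt hu)
    (mfderiv_extChartAt_comp_chartSymmDeriv hu)) _)

lemma chartSymmDeriv_chartField (hu : u ∈ (extChartAt I z).target)
    (F : Π x : M, TangentSpace I x) :
    chartSymmDeriv I z u (chartField z F u) = F ((extChartAt I z).symm u) := by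
  rw [chartField_apply hu]
  exact congr($(chartSymmDeriv_comp_mfderiv_extChartAt hu) _)

lemma chartConstField_extChartAt_symm (hu : u ∈ (extChartAt I z).target) (v : E) :
    chartConstField I z v ((extChartAt I z).symm u) = chartSymmDeriv I z u v := by
  have hx : (extChartAt I z).symm u ∈ (chartAt H z).source := by
    simpa using (extChartAt I z).map_target hu
  have h := congr($(TangentBundle.symmL_trivializationAt (I := I) hx) v)
  rw [Trivialization.symmL_apply _ (by simpa using hx)] at h
  rw [chartSymmDeriv_eq_mfderivWithin]
  refine h.trans ?_
  rw [(extChartAt I z).right_inv hu]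
  rfl

lemma chartField_chartConstField (hu : u ∈ (extChartAt I z).target) (v : E) :
    chartField z (chartConstField I z v) u = v := by
  rw [chartField_apply hu, chartConstField_extChartAt_symm hu]
  exact congr($(mfderiv_extChartAt_comp_chartSymmDeriv hu) v)

lemma contDiffAt_chartField [CompleteSpace E] {n : ℕ∞} {F : Π x : M, TangentSpace I x}
    (hF : ContMDiffAt I I.tangent n (T% F) z) :
    ContDiffAt ℝ n (chartField z F) (extChartAt I z z) := by
  have h := VectorField.contMDiffWithinAt_mpullbackWithin_extChartAt_symm (n := ∞)
    (m := n) (s := univ) hF.contMDiffWithinAt uniqueMDiffOn_univ (mem_univ z)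
    (by exact_mod_cast le_top)
  rw [contMDiffWithinAt_vectorSpace_iff_contDiffWithinAt] at h
  refine h.contDiffAt ?_
  simpa using extChartAt_target_mem_nhds z

lemma mlieBracket_chartConstField (z : M) (v : E) (F : Π x : M, TangentSpace I x) :
    VectorField.mlieBracket I (chartConstField I z v) F ((extChartAt I z).symm (extChartAt I z z)) =
      chartSymmDeriv I z (extChartAt I z z)
        (fderiv ℝ (chartField z F) (extChartAt I z z) v) := by
  have hz := mem_extChartAt_target (I := I) z
  have hchart (x : M) (hx : x = z) : VectorField.mlieBracket I (chartConstField I z v) F x =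
      (mfderiv I 𝓘(ℝ, E) (extChartAt I z) x).inverse (VectorField.lieBracketWithin ℝ (E := E)
        (chartField z (chartConstField I z v)) (chartField z F)
        ((extChartAt I z).symm ⁻¹' univ ∩ range I) (extChartAt I z z)) := by
    subst hx
    rfl
  have hconst : chartField z (chartConstField I z v) =ᶠ[𝓝 (extChartAt I z z)] fun _ ↦ v := by
    filter_upwards [extChartAt_target_mem_nhds z] with u hu using chartField_chartConstField hu v
  have hbracket : VectorField.lieBracketWithin ℝ (E := E) (chartField z (chartConstField I z v))
      (chartField z F) ((extChartAt I z).symm ⁻¹' univ ∩ range I) (extChartAt I z z) =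
        fderiv ℝ (chartField z F) (extChartAt I z z) v := by
    rw [I.range_eq_univ, preimage_univ, inter_univ, VectorField.lieBracketWithin_univ,
      VectorField.lieBracket, hconst.fderiv_eq, hconst.eq_of_nhds]
    simp
  rw [hchart _ (extChartAt_to_inv z), inverse_mfderiv_extChartAt hz]
  exact congrArg (chartSymmDeriv I z (extChartAt I z z)) hbracket

end Chart

section FirstVariation

variable {E : Type*} [NormedAddCommGroup E] [NormedSpace ℝ E] [FiniteDimensional ℝ E]
  {H : Type*} [TopologicalSpace H] {I : ModelWithCorners ℝ E H}
  {M : Type*} [TopologicalSpace M] [ChartedSpace H M] [IsManifold I ∞ M]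
  [RiemannianBundle (fun x : M ↦ TangentSpace I x)]
  [IsContMDiffRiemannianBundle I ∞ E (fun x : M ↦ TangentSpace I x)]

/-- `F⟨V, V⟩ = 2⟨∇_F V, V⟩` because `∇` is metric, and `∇_V F = ∇_F V + [V, F]` because it is
torsion-free. -/
lemma two_mul_inner_leviCivita_self {F V : Π x : M, TangentSpace I x} {x : M}
    (hF : MDiffAt (T% F) x) (hV : MDiffAt (T% V) x) :
    2 * inner ℝ (leviCivita I M F x (V x)) (V x) =
      d% (fun y ↦ inner ℝ (V y) (V y)) x (F x)
        + 2 * inner ℝ (VectorField.mlieBracket I V F x) (V x) := by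
  have : CompleteSpace E := FiniteDimensional.complete ℝ E
  have htorsion := (CovariantDerivative.torsion_eq_zero_iff _).1
    (leviCivita_torsion (I := I) (M := M)) hV hF
  rw [leviCivita_metric hF hV hV, ← htorsion, inner_sub_left,
    real_inner_comm (leviCivita I M V x (F x))]
  ring

end FirstVariation

section ChartMetric

variable {E : Type*} [NormedAddCommGroup E] [NormedSpace ℝ E]
  {H : Type*} [TopologicalSpace H] {I : ModelWithCorners ℝ E H}
  {M : Type*} [TopologicalSpace M] [ChartedSpace H M]
  [RiemannianBundle (fun x : M ↦ TangentSpace I x)]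

variable (I) in
/-- The Riemannian metric in the preferred chart at `z`. It is meaningful on the target of the
chart only. -/
def chartMetric (z : M) (u : E) : E →L[ℝ] E →L[ℝ] ℝ :=
  (innerSL ℝ (E := TangentSpace I ((extChartAt I z).symm u))).bilinearComp
    (chartSymmDeriv I z u) (chartSymmDeriv I z u)

lemma chartMetric_apply (z : M) (u v w : E) : chartMetric I z u v w =
    inner ℝ (chartSymmDeriv I z u v) (chartSymmDeriv I z u w) := by
  rfl

lemma chartMetric_apply_self (z : M) (u v : E) :
    chartMetric I z u v v = ‖chartSymmDeriv I z u v‖ ^ 2 := by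
  rw [chartMetric_apply, real_inner_self_eq_norm_sq]

variable [IsManifold I ∞ M] [I.Boundaryless]

lemma chartMetric_eq_inner_chartConstField {z : M} {u : E} (hu : u ∈ (extChartAt I z).target)
    (v w : E) : chartMetric I z u v w = inner ℝ (chartConstField I z v ((extChartAt I z).symm u))
      (chartConstField I z w ((extChartAt I z).symm u)) := by
  rw [chartMetric_apply, chartConstField_extChartAt_symm hu, chartConstField_extChartAt_symm hu]

lemma exists_mul_sq_norm_le_chartMetric {z : M} {u : E} (hu : u ∈ (extChartAt I z).target) :
    ∃ c > 0, ∀ v, c * ‖v‖ ^ 2 ≤ chartMetric I z u v v := by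
  set B : TangentSpace I ((extChartAt I z).symm u) →L[ℝ] E :=
    mfderiv I 𝓘(ℝ, E) (extChartAt I z) ((extChartAt I z).symm u)
  have hB (v : E) : ‖v‖ ≤ (‖B‖ + 1) * ‖chartSymmDeriv I z u v‖ := by
    have hv : B (chartSymmDeriv I z u v) = v :=
      congr($(mfderiv_extChartAt_comp_chartSymmDeriv hu) v)
    calc ‖v‖ = ‖B (chartSymmDeriv I z u v)‖ := by rw [hv]
      _ ≤ ‖B‖ * ‖chartSymmDeriv I z u v‖ := B.le_opNorm _
      _ ≤ (‖B‖ + 1) * ‖chartSymmDeriv I z u v‖ := by gcongr; linarith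
  refine ⟨((‖B‖ + 1) ^ 2)⁻¹, by positivity, fun v ↦ ?_⟩
  rw [chartMetric_apply_self, inv_mul_le_iff₀ (by positivity), ← mul_pow]
  gcongr
  exact hB v

variable [FiniteDimensional ℝ E]
  [IsContMDiffRiemannianBundle I ∞ E (fun x : M ↦ TangentSpace I x)]

lemma contDiffOn_chartMetric (z : M) :
    ContDiffOn ℝ ∞ (chartMetric I z) (extChartAt I z).target := by
  simp only [contDiffOn_clm_apply]
  intro v w
  rw [← contMDiffOn_iff_contDiffOn]
  have hinner : ContMDiffOn I 𝓘(ℝ, ℝ) ∞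
      (fun x ↦ inner ℝ (chartConstField I z v x) (chartConstField I z w x)) (chartAt H z).source :=
    ContMDiffOn.inner_bundle (IB := I) (F := E) (E := fun x : M ↦ TangentSpace I x) (b := id)
      (contMDiffOn_chartConstField z v) (contMDiffOn_chartConstField z w)
  refine (hinner.comp (contMDiffOn_extChartAt_symm z) fun u hu ↦ ?_).congr
    fun u hu ↦ chartMetric_eq_inner_chartConstField hu v w
  simpa using (extChartAt I z).map_target hu

lemma contDiffAt_chartMetric (z : M) :
    ContDiffAt ℝ ∞ (chartMetric I z) (extChartAt I z z) :=
  (contDiffOn_chartMetric z).contDiffAt (extChartAt_target_mem_nhds z)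

lemma fderiv_chartMetric_apply (z : M) (v w : E) (F : Π x : M, TangentSpace I x) :
    fderiv ℝ (chartMetric I z) (extChartAt I z z) (chartField z F (extChartAt I z z)) v w =
      d% (fun y ↦ inner ℝ (chartConstField I z v y) (chartConstField I z w y))
        ((extChartAt I z).symm (extChartAt I z z))
        (F ((extChartAt I z).symm (extChartAt I z z))) := by
  have hz := mem_extChartAt_target (I := I) z
  set u := extChartAt I z z
  set g := fun y ↦ inner ℝ (chartConstField I z v y) (chartConstField I z w y)
  have hx : (chartAt H z).source ∈ 𝓝 ((extChartAt I z).symm u) := by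
    simpa [u] using chart_source_mem_nhds H z
  have hg : MDiffAt g ((extChartAt I z).symm u) :=
    mdiff_inner (((contMDiffOn_chartConstField z v).contMDiffAt hx).mdifferentiableAt (by simp))
      (((contMDiffOn_chartConstField z w).contMDiffAt hx).mdifferentiableAt (by simp))
  have hgsymm : HasFDerivAt (g ∘ (extChartAt I z).symm)
      ((d% g ((extChartAt I z).symm u)).comp (chartSymmDeriv I z u)) u :=
    (hg.hasMFDerivAt.comp u (hasMFDerivAt_extChartAt_symm hz)).hasFDerivAt
  have hchart : HasFDerivAt (fun u ↦ chartMetric I z u v w)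
      ((d% g ((extChartAt I z).symm u)).comp (chartSymmDeriv I z u)) u := by
    refine hgsymm.congr_of_eventuallyEq ?_
    filter_upwards [extChartAt_target_mem_nhds z] with u hu
      using chartMetric_eq_inner_chartConstField hu v w
  have happly : HasFDerivAt (fun u ↦ chartMetric I z u v w) _ u :=
    (((contDiffAt_chartMetric z).differentiableAt (by simp)).hasFDerivAt.clm_apply
      (hasFDerivAt_const v u)).clm_apply (hasFDerivAt_const w u)
  rw [← chartSymmDeriv_chartField hz F]
  refine Eq.trans ?_ congr($(happly.unique hchart) (chartField z F u))
  simp [u]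

lemma lie_chartMetric_apply_self (z : M) (v : E) {F : Π x : M, TangentSpace I x}
    (hF : MDiffAt (T% F) z) :
    fderiv ℝ (chartMetric I z) (extChartAt I z z) (chartField z F (extChartAt I z z)) v v
      + chartMetric I z (extChartAt I z z) (fderiv ℝ (chartField z F) (extChartAt I z z) v) v
      + chartMetric I z (extChartAt I z z) v (fderiv ℝ (chartField z F) (extChartAt I z z) v) =
    2 * inner ℝ (leviCivita I M F ((extChartAt I z).symm (extChartAt I z z))
        (chartSymmDeriv I z (extChartAt I z z) v)) (chartSymmDeriv I z (extChartAt I z z) v) := by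
  have hV : MDiffAt (T% (chartConstField I z v)) ((extChartAt I z).symm (extChartAt I z z)) := by
    refine ((contMDiffOn_chartConstField z v).contMDiffAt ?_).mdifferentiableAt (by simp)
    simpa using chart_source_mem_nhds H z
  have h := two_mul_inner_leviCivita_self
    ((extChartAt_to_inv (I := I) z).symm ▸ hF) hV
  rw [chartConstField_extChartAt_symm (mem_extChartAt_target z), mlieBracket_chartConstField,
    ← fderiv_chartMetric_apply] at h
  rw [h, chartMetric_apply, chartMetric_apply, real_inner_comm (chartSymmDeriv I z _ v)]
  ring

end ChartMetric

section EulerStep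

open scoped NNReal ENNReal
open Asymptotics

variable {E : Type*} [NormedAddCommGroup E] [NormedSpace ℝ E]
  {H : Type*} [TopologicalSpace H] {I : ModelWithCorners ℝ E H}

section Differential

variable {M : Type*} [TopologicalSpace M] [ChartedSpace H M]
  {F : Π x : M, TangentSpace I x} {z x : M}

/-- The Euler step of size `s` for the vector field `F`, in the preferred chart at `z`. -/
def eulerStep (z : M) (F : Π x : M, TangentSpace I x) (s : ℝ) (x : M) : M :=
  (extChartAt I z).symm (extChartAt I z x + s • chartField z F (extChartAt I z x))

variable [IsManifold I ∞ M] [I.Boundaryless]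

lemma chartField_extChartAt (hx : x ∈ (extChartAt I z).source) (F : Π x : M, TangentSpace I x) :
    chartField z F (extChartAt I z x) = mfderiv I 𝓘(ℝ, E) (extChartAt I z) x (F x) := by
  obtain ⟨u, hu, rfl⟩ := (extChartAt I z).symm.surjOn hx
  exact (congrArg _ ((extChartAt I z).right_inv hu)).trans (chartField_apply hu F)

lemma hasDerivAt_extChartAt_comp {γ : ℝ → M} (hγ : IsMIntegralCurve γ F) {t : ℝ}
    (ht : γ t ∈ (extChartAt I z).source) :
    HasDerivAt (extChartAt I z ∘ γ) (chartField z F (extChartAt I z (γ t))) t := by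
  have hchart := (mdifferentiableAt_extChartAt (I := I) (by simpa using ht)).hasMFDerivAt
  obtain ⟨T, hT, hderiv⟩ : ∃ T : ℝ →L[ℝ] E, T 1 = chartField z F (extChartAt I z (γ t)) ∧
      HasFDerivAt (extChartAt I z ∘ γ) T t := by
    refine ⟨_, ?_, (hchart.comp t (hγ t)).hasFDerivAt⟩
    rw [chartField_extChartAt ht]
    exact congrArg (mfderiv I 𝓘(ℝ, E) (extChartAt I z) (γ t)) (one_smul ℝ (F (γ t)))
  exact hT ▸ hderiv.hasDerivAt

lemma contMDiffAt_eulerStep {s : ℝ} (hx : x ∈ (extChartAt I z).source)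
    (hs : extChartAt I z x + s • chartField z F (extChartAt I z x) ∈ (extChartAt I z).target)
    (hf : ContDiffAt ℝ 1 (chartField z F) (extChartAt I z x)) :
    ContMDiffAt I I 1 (eulerStep z F s) x := by
  have hline : ContMDiffAt 𝓘(ℝ, E) 𝓘(ℝ, E) 1 (fun u ↦ u + s • chartField z F u)
      (extChartAt I z x) := (contDiffAt_id.add (contDiffAt_const.smul hf)).contMDiffAt
  exact ((contMDiffAt_extChartAt_symm hs).of_le (by simp)).comp x
    (hline.comp x (contMDiffAt_extChartAt' (by simpa using hx)))

lemma mfderiv_eulerStep_apply {s : ℝ} (hx : x ∈ (extChartAt I z).source)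
    (hs : extChartAt I z x + s • chartField z F (extChartAt I z x) ∈ (extChartAt I z).target)
    (hf : DifferentiableAt ℝ (chartField z F) (extChartAt I z x)) (w : TangentSpace I x) :
    mfderiv I I (eulerStep z F s) x w =
      chartSymmDeriv I z (extChartAt I z x + s • chartField z F (extChartAt I z x))
        ((.id ℝ E + s • fderiv ℝ (chartField z F) (extChartAt I z x) : E →L[ℝ] E)
          (mfderiv I 𝓘(ℝ, E) (extChartAt I z) x w)) := by
  have hchart := (mdifferentiableAt_extChartAt (I := I) (by simpa using hx)).hasMFDerivAt
  have hline := ((hasFDerivAt_id _).add (hf.hasFDerivAt.const_smul s)).hasMFDerivAt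
  have hstep : HasMFDerivAt I I (eulerStep z F s) x _ :=
    (hasMFDerivAt_extChartAt_symm hs).comp x (hline.comp x hchart)
  exact congr($(hstep.mfderiv) w)

lemma enorm_chartSymmDeriv_mfderiv_extChartAt [RiemannianBundle (fun x : M ↦ TangentSpace I x)]
    (hx : x ∈ (extChartAt I z).source) (w : TangentSpace I x) :
    ‖chartSymmDeriv I z (extChartAt I z x) (mfderiv I 𝓘(ℝ, E) (extChartAt I z) x w)‖ₑ = ‖w‖ₑ := by
  obtain ⟨u, hu, rfl⟩ := (extChartAt I z).symm.surjOn hx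
  have key (u' : E) (hu' : u' = u) : ‖chartSymmDeriv I z u'
      (mfderiv I 𝓘(ℝ, E) (extChartAt I z) ((extChartAt I z).symm u) w)‖ₑ = ‖w‖ₑ := by
    subst hu'
    exact congrArg _ congr($(chartSymmDeriv_comp_mfderiv_extChartAt hu) w)
  exact key _ ((extChartAt I z).right_inv hu)

end Differential

lemma enorm_le_toNNReal_mul_enorm {V W : Type*} [SeminormedAddGroup V] [SeminormedAddGroup W]
    {a : V} {b : W} {c : ℝ} (h : ‖a‖ ≤ c * ‖b‖) : ‖a‖ₑ ≤ c.toNNReal * ‖b‖ₑ := by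
  rw [← ofReal_norm, ← ofReal_norm, ← ENNReal.ofReal, ← ENNReal.ofReal_mul' (norm_nonneg b)]
  exact ENNReal.ofReal_le_ofReal h

section Estimates

variable {M : Type*} [PseudoMetricSpace M] [ChartedSpace H M] [IsManifold I ∞ M]
  [I.Boundaryless] [FiniteDimensional ℝ E] [RiemannianBundle (fun x : M ↦ TangentSpace I x)]
  [IsContMDiffRiemannianBundle I ∞ E (fun x : M ↦ TangentSpace I x)]
  {F : Π x : M, TangentSpace I x}

lemma eventually_norm_chartSymmDeriv_euler_le {z : M} (hF : ContMDiffAt I I.tangent 1 (T% F) z)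
    {L K : ℝ} (hFL : ∀ v, inner ℝ (leviCivita I M F z v) v ≤ L * ‖v‖ ^ 2) (hK : L < K) :
    ∀ᶠ p : ℝ × E in 𝓝 (0, extChartAt I z z), 0 ≤ p.1 → ∀ v,
      ‖chartSymmDeriv I z (p.2 + p.1 • chartField z F p.2)
        (v + p.1 • fderiv ℝ (chartField z F) p.2 v)‖ ≤
          (1 + K * p.1) * ‖chartSymmDeriv I z p.2 v‖ := by
  have : CompleteSpace E := FiniteDimensional.complete ℝ E
  obtain ⟨c, hc, hpos⟩ := exists_mul_sq_norm_le_chartMetric (mem_extChartAt_target (I := I) z)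
  have hFL' (x : M) (hx : x = z) (w : TangentSpace I x) :
      inner ℝ (leviCivita I M F x w) w ≤ L * ‖w‖ ^ 2 := by
    subst hx
    exact hFL w
  have hLie (v : E) := (lie_chartMetric_apply_self z v (hF.mdifferentiableAt one_ne_zero)).trans_le
    (mul_le_mul_of_nonneg_left (hFL' _ (extChartAt_to_inv z) _) zero_le_two)
  simp only [← chartMetric_apply_self, ← mul_assoc] at hLie
  have hpullback := eventually_eulerPullback_le ((contDiffAt_chartMetric z).of_le (by simp))
    (contDiffAt_chartField hF) hc hpos (mul_lt_mul_of_pos_left hK two_pos) hLie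
  have hsmall : ∀ᶠ p : ℝ × E in 𝓝 (0, extChartAt I z z), 0 < 1 + K * p.1 :=
    (show Continuous fun p : ℝ × E ↦ 1 + K * p.1 by fun_prop).continuousAt.eventually
      (lt_mem_nhds (by simp))
  filter_upwards [hpullback, hsmall] with p hp hp0 hp1 v
  specialize hp hp1 v
  rw [chartMetric_apply_self, chartMetric_apply_self] at hp
  refine le_of_sq_le_sq (hp.trans ?_) (by positivity)
  rw [mul_pow]
  gcongr
  linarith [sq_nonneg (K * p.1)]

lemma exists_eventually_norm_chartSymmDeriv_le (z : M) :
    ∃ C : ℝ≥0, ∀ᶠ u in 𝓝 (extChartAt I z z), ∀ v, ‖chartSymmDeriv I z u v‖ ≤ C * ‖v‖ := by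
  have hG : ∀ᶠ u in 𝓝 (extChartAt I z z),
      ‖chartMetric I z u‖ < ‖chartMetric I z (extChartAt I z z)‖ + 1 :=
    (contDiffAt_chartMetric z).continuousAt.norm.eventually (gt_mem_nhds (lt_add_one _))
  refine ⟨NNReal.sqrt (‖chartMetric I z (extChartAt I z z)‖₊ + 1), ?_⟩
  filter_upwards [hG] with u hu v
  refine le_of_sq_le_sq ?_ (by positivity)
  calc ‖chartSymmDeriv I z u v‖ ^ 2 = chartMetric I z u v v := (chartMetric_apply_self z u v).symm
    _ ≤ ‖chartMetric I z u‖ * ‖v‖ * ‖v‖ :=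
      (Real.le_norm_self _).trans ((chartMetric I z u).le_opNorm₂ v v)
    _ ≤ (‖chartMetric I z (extChartAt I z z)‖ + 1) * ‖v‖ * ‖v‖ := by gcongr
    _ = (NNReal.sqrt (‖chartMetric I z (extChartAt I z z)‖₊ + 1) * ‖v‖) ^ 2 := by
      rw [mul_pow, Real.coe_sqrt, Real.sq_sqrt (by positivity)]
      push_cast
      ring

variable [IsRiemannianManifold I M]

lemma exists_lipschitzOnWith_extChartAt_symm (z : M) :
    ∃ C, ∃ s ∈ 𝓝 (extChartAt I z z), LipschitzOnWith C (extChartAt I z).symm s := by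
  obtain ⟨C, hC⟩ := exists_eventually_norm_chartSymmDeriv_le (I := I) z
  obtain ⟨ρ, hρ, hball⟩ := Metric.eventually_nhds_iff_ball.1
    (hC.and (extChartAt_target_mem_nhds (I := I) z))
  refine ⟨C, _, Metric.ball_mem_nhds _ hρ, lipschitzOnWith_of_enorm_mfderiv_le (convex_ball _ _)
    (fun u hu ↦ (contMDiffAt_extChartAt_symm (hball u hu).2).of_le (by simp)) fun u hu v ↦ ?_⟩
  simp only [enorm_eq_nnnorm]
  exact_mod_cast (hball u hu).1 v

lemma eventually_isLittleO_dist_eulerStep (z : M) (F : Π x : M, TangentSpace I x) :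
    ∀ᶠ x in 𝓝 z, ∀ (γ : ℝ → M) (t : ℝ), IsMIntegralCurve γ F → γ t = x →
      (fun s ↦ dist (γ s) (eulerStep z F (s - t) (γ t))) =o[𝓝 t] fun s ↦ s - t := by
  obtain ⟨C, A, hA, hC⟩ := exists_lipschitzOnWith_extChartAt_symm (I := I) z
  filter_upwards [extChartAt_source_mem_nhds (I := I) z,
    (continuousAt_extChartAt (I := I) z).eventually (eventually_mem_nhds_iff.2 hA)] with x hx hxA
  rintro γ t hγ rfl
  have hderiv := hasDerivAt_extChartAt_comp hγ hx
  have hsource : ∀ᶠ s in 𝓝 t, γ s ∈ (extChartAt I z).source :=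
    (hγ t).continuousAt.eventually ((isOpen_extChartAt_source z).mem_nhds hx)
  have hcurve : ∀ᶠ s in 𝓝 t, extChartAt I z (γ s) ∈ A := hderiv.continuousAt.eventually hxA
  have hline : ∀ᶠ s in 𝓝 t, extChartAt I z (γ t) +
      (s - t) • chartField z F (extChartAt I z (γ t)) ∈ A := by
    have hcont : Continuous fun s ↦ extChartAt I z (γ t) +
      (s - t) • chartField z F (extChartAt I z (γ t)) := by fun_prop
    exact hcont.continuousAt.eventually (by simpa using hxA)
  refine IsBigO.trans_isLittleO (.of_bound C ?_) hderiv.isLittleO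
  filter_upwards [hsource, hcurve, hline] with s hs hs1 hs2
  have hdist := hC.dist_le_mul _ hs1 _ hs2
  rw [(extChartAt I z).left_inv hs] at hdist
  simpa [eulerStep, dist_eq_norm, sub_sub] using hdist

lemma exists_lipschitzOnWith_eulerStep {z : M} (hF : ContMDiffAt I I.tangent 1 (T% F) z)
    {L K : ℝ} (hFL : ∀ v, inner ℝ (leviCivita I M F z v) v ≤ L * ‖v‖ ^ 2) (hK : L < K) :
    ∃ δ > 0, ∀ᶠ s in 𝓝[>] (0 : ℝ),
      LipschitzOnWith (1 + K * s).toNNReal (eulerStep z F s) (Metric.ball z δ) := by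
  have : CompleteSpace E := FiniteDimensional.complete ℝ E
  have hf := contDiffAt_chartField hF
  have hsmooth : ∀ᶠ p : ℝ × E in 𝓝 (0, extChartAt I z z), ContDiffAt ℝ 1 (chartField z F) p.2 :=
    continuousAt_snd.eventually (hf.eventually (by simp))
  have htarget : ∀ᶠ p : ℝ × E in 𝓝 (0, extChartAt I z z),
      p.2 + p.1 • chartField z F p.2 ∈ (extChartAt I z).target := by
    have hcont : ContinuousAt (fun p : ℝ × E ↦ p.2 + p.1 • chartField z F p.2)
        (0, extChartAt I z z) := continuousAt_snd.add (continuousAt_fst.smul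
      (ContinuousAt.comp (g := chartField z F) hf.continuousAt continuousAt_snd))
    refine hcont.eventually ?_
    simpa only [zero_smul, add_zero] using
      eventually_mem_set.2 (extChartAt_target_mem_nhds (I := I) z)
  have hlocal := (eventually_norm_chartSymmDeriv_euler_le hF hFL hK).and (hsmooth.and htarget)
  rw [nhds_prod_eq] at hlocal
  obtain ⟨P, hP, Q, hQ, hPQ⟩ := eventually_prod_iff.1 hlocal
  obtain ⟨δ, hδ, hball⟩ := Metric.eventually_nhds_iff_ball.1
    (Eventually.and (extChartAt_source_mem_nhds (I := I) z)
      ((continuousAt_extChartAt (I := I) z).eventually hQ))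
  refine ⟨δ / 3, by positivity, ?_⟩
  rw [show δ = 3 * (δ / 3) by ring] at hball
  filter_upwards [nhdsWithin_le_nhds hP, self_mem_nhdsWithin] with s hs hs0
  refine lipschitzOnWith_ball_of_enorm_mfderiv_le (I := I) (I' := I) (fun x hx ↦ ?_)
    fun x hx w ↦ ?_
  · obtain ⟨hx, hQx⟩ := hball x hx
    exact contMDiffAt_eulerStep hx (hPQ hs hQx).2.2 (hPQ hs hQx).2.1
  · obtain ⟨hx, hQx⟩ := hball x hx
    obtain ⟨hnorm, hfx, hsx⟩ := hPQ hs hQx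
    rw [mfderiv_eulerStep_apply hx hsx (hfx.differentiableAt one_ne_zero)]
    exact (enorm_le_toNNReal_mul_enorm (hnorm (mem_Ioi.1 hs0).le _)).trans_eq
      (congrArg _ (enorm_chartSymmDeriv_mfderiv_extChartAt hx w))

end Estimates

end EulerStep

lemma inner_apply_self_le_of_norm_le {V : Type*} [SeminormedAddCommGroup V] [InnerProductSpace ℝ V]
    {A : V →L[ℝ] V} {c : ℝ} (hA : ‖A‖ ≤ c) (v : V) : inner ℝ (A v) v ≤ c * ‖v‖ ^ 2 := by
  rw [sq, ← mul_assoc]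
  exact (real_inner_le_norm _ _).trans (by gcongr; exact A.le_of_opNorm_le hA v)

section FlowEstimates

variable {E : Type*} [NormedAddCommGroup E] [NormedSpace ℝ E] [FiniteDimensional ℝ E]
  {H : Type*} [TopologicalSpace H] {I : ModelWithCorners ℝ E H} [I.Boundaryless]
  {M : Type*} [MetricSpace M] [ChartedSpace H M] [IsManifold I ∞ M]
  [RiemannianBundle (fun x : M ↦ TangentSpace I x)]
  [IsContMDiffRiemannianBundle I ∞ E (fun x : M ↦ TangentSpace I x)]
  [IsRiemannianManifold I M]
  {F : Π x : M, TangentSpace I x} {L K : ℝ}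

lemma exists_eventually_slope_dist_lt {z : M} (hF : ContMDiffAt I I.tangent 1 (T% F) z)
    (hFL : ∀ v, inner ℝ (leviCivita I M F z v) v ≤ L * ‖v‖ ^ 2) (hK : L < K) :
    ∃ δ > 0, ∀ γ η : ℝ → M, IsMIntegralCurve γ F → IsMIntegralCurve η F → ∀ t,
      γ t ∈ Metric.ball z δ → η t ∈ Metric.ball z δ → ∀ r, K * dist (γ t) (η t) < r →
        ∀ᶠ s in 𝓝[>] t, slope (fun s ↦ dist (γ s) (η s)) t s < r := by
  obtain ⟨δ₁, hδ₁, hlip⟩ := exists_lipschitzOnWith_eulerStep hF hFL hK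
  obtain ⟨δ₂, hδ₂, hlocal⟩ :=
    Metric.eventually_nhds_iff_ball.1 (eventually_isLittleO_dist_eulerStep z F)
  refine ⟨min δ₁ δ₂, lt_min hδ₁ hδ₂, fun γ η hγ hη t hγt hηt r hr ↦ ?_⟩
  have hball₁ := Metric.ball_subset_ball (x := z) (min_le_left δ₁ δ₂)
  have hball₂ := Metric.ball_subset_ball (x := z) (min_le_right δ₁ δ₂)
  obtain ⟨ε, hε, hεr⟩ : ∃ ε > 0, K * dist (γ t) (η t) + 2 * ε < r :=
    ⟨(r - K * dist (γ t) (η t)) / 3, by linarith, by linarith⟩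
  have hsub : Tendsto (fun s ↦ s - t) (𝓝[>] t) (𝓝[>] 0) :=
    tendsto_nhdsWithin_iff.2 ⟨((continuous_sub_right t).tendsto' _ _ (sub_self t)).mono_left
      nhdsWithin_le_nhds, eventually_mem_nhdsWithin.mono fun s hs ↦ sub_pos.2 (mem_Ioi.1 hs)⟩
  have hfactor : ∀ᶠ s in 𝓝[>] t, 0 < 1 + K * (s - t) :=
    ((by fun_prop : Continuous fun s ↦ 1 + K * (s - t)).continuousAt.eventually
      (lt_mem_nhds (by simp))).filter_mono nhdsWithin_le_nhds
  filter_upwards [hsub.eventually hlip, hfactor, self_mem_nhdsWithin,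
    nhdsWithin_le_nhds ((hlocal _ (hball₂ hγt) γ t hγ rfl).def hε),
    nhdsWithin_le_nhds ((hlocal _ (hball₂ hηt) η t hη rfl).def hε)] with s hs hs0 hts hγs hηs
  have hts : 0 < s - t := sub_pos.2 (mem_Ioi.1 hts)
  have hstep := hs.dist_le_mul _ (hball₁ hγt) _ (hball₁ hηt)
  rw [Real.coe_toNNReal _ hs0.le] at hstep
  rw [Real.norm_of_nonneg dist_nonneg, Real.norm_of_nonneg hts.le] at hγs hηs
  rw [dist_comm] at hηs
  have htriangle := dist_triangle4 (γ s) (eulerStep z F (s - t) (γ t))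
    (eulerStep z F (s - t) (η t)) (η s)
  rw [slope_def_field, div_lt_iff₀ hts]
  linarith [mul_lt_mul_of_pos_right hεr hts]

lemma eventually_dist_flow_le (hF : ContMDiff I I.tangent 1 (T% F))
    (hFL : ∀ x v, inner ℝ (leviCivita I M F x v) v ≤ L * ‖v‖ ^ 2) (hK : L < K)
    (hFc : IsCompleteVectorField F) {T : ℝ} (hT : 0 ≤ T) (x : M) :
    ∀ᶠ y in 𝓝 x, dist (flow hFc T x) (flow hFc T y) ≤ Real.exp (K * T) * dist x y := by
  obtain ⟨K₀, hLK₀, hK₀⟩ := exists_between hK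
  choose δ hδ hslope using fun z ↦ exists_eventually_slope_dist_lt (hF z) (hFL z) hLK₀
  have hcont (y : M) : Continuous fun t ↦ flow hFc t y :=
    continuous_iff_continuousAt.2 fun t ↦ (isMIntegralCurve_flow hFc y t).continuousAt
  obtain ⟨ρ, hρ, hρδ⟩ := lebesgue_number_lemma_of_metric
    (isCompact_Icc.image (hcont x) : IsCompact ((fun t ↦ flow hFc t x) '' Icc 0 T))
    (c := fun z ↦ Metric.ball z (δ z)) (fun _ ↦ Metric.isOpen_ball)
    (fun z _ ↦ mem_iUnion.2 ⟨z, Metric.mem_ball_self (hδ z)⟩)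
  have hnear : ∀ᶠ y in 𝓝 x, dist x y * Real.exp (|K| * T) < ρ :=
    (by fun_prop : Continuous fun y ↦ dist x y * Real.exp (|K| * T)).continuousAt.eventually
      (gt_mem_nhds (by simpa using hρ))
  filter_upwards [hnear] with y hy
  rcases eq_or_ne x y with rfl | hxy
  · simp
  have hgronwall := le_mul_exp_of_liminf_slope_le (d := fun t ↦ dist (flow hFc t x) (flow hFc t y))
    (T := T) (δ := ρ) hK₀ ((hcont x).dist (hcont y)).continuousOn
    (by simpa only [flow_zero] using dist_pos.2 hxy)
    (fun t ht hd r hr ↦ ?_) (fun t ht ↦ ?_) T (right_mem_Icc.2 hT)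
  · simpa only [flow_zero, mul_comm] using hgronwall
  · obtain ⟨z, hz⟩ := hρδ _ (mem_image_of_mem _ (Ico_subset_Icc_self ht))
    exact (hslope z _ _ (isMIntegralCurve_flow hFc x) (isMIntegralCurve_flow hFc y) t
      (hz (Metric.mem_ball_self hρ)) (hz (Metric.mem_ball'.2 hd)) r hr).frequently
  · rw [flow_zero, flow_zero]
    refine lt_of_le_of_lt ?_ hy
    gcongr
    exacts [ht.1, le_abs_self K, ht.2]

theorem dist_flow_le (hF : ContMDiff I I.tangent 1 (T% F))
    (hFL : ∀ x v, inner ℝ (leviCivita I M F x v) v ≤ L * ‖v‖ ^ 2)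
    (hFc : IsCompleteVectorField F) {T : ℝ} (hT : 0 ≤ T) (x y : M) :
    dist (flow hFc T x) (flow hFc T y) ≤ Real.exp (L * T) * dist x y := by
  have hlt (K : ℝ) (hK : L < K) :
      dist (flow hFc T x) (flow hFc T y) ≤ Real.exp (K * T) * dist x y := by
    have hlip : LipschitzWith (Real.exp (K * T)).toNNReal (flow hFc T) := by
      refine lipschitzWith_of_eventually_edist_le I fun x ↦ ?_
      filter_upwards [eventually_dist_flow_le hF hFL hK hFc hT x] with y hy
      rw [edist_dist, edist_dist, ← ENNReal.ofReal, ← ENNReal.ofReal_mul (Real.exp_pos _).le]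
      exact ENNReal.ofReal_le_ofReal hy
    simpa only [Real.coe_toNNReal _ (Real.exp_pos _).le] using hlip.dist_le_mul x y
  have hlim : Tendsto (fun K ↦ Real.exp (K * T) * dist x y) (𝓝[>] L)
      (𝓝 (Real.exp (L * T) * dist x y)) :=
    ((by fun_prop : Continuous fun K ↦ Real.exp (K * T) * dist x y).tendsto L).mono_left
      nhdsWithin_le_nhds
  exact ge_of_tendsto hlim (eventually_mem_nhdsWithin.mono hlt)

end FlowEstimates

end RiemannianError

end

theorem mainTheorem1_general
    {E : Type*} [NormedAddCommGroup E] [NormedSpace ℝ E] [FiniteDimensional ℝ E]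
    {H : Type*} [TopologicalSpace H] {I : ModelWithCorners ℝ E H} [I.Boundaryless]
    {M : Type*} [MetricSpace M] [ChartedSpace H M] [IsManifold I ∞ M]
    [RiemannianBundle (fun x : M ↦ TangentSpace I x)]
    [IsContMDiffRiemannianBundle I ∞ E (fun x : M ↦ TangentSpace I x)]
    [IsRiemannianManifold I M] {F : Π x : M, TangentSpace I x}
    (hF : ContMDiff I I.tangent 1 (fun x ↦ (⟨x, F x⟩ : TangentBundle I M)))
    (hFc : RiemannianError.IsCompleteVectorField F) {L : ℝ} (hL : 0 < L)
    (hFL : ∀ x v, inner ℝ (RiemannianError.leviCivita I M F x v) v ≤ L * ‖v‖ ^ 2)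
    {ψ : M → M} {C h : ℝ} {p : ℕ} (hh : 0 < h)
    (hψ : ∀ u, dist (ψ u) (RiemannianError.flow hFc h u) ≤ C * h ^ (p + 1))
    {u : ℕ → M} (hu : ∀ k, u (k + 1) = ψ (u k)) (k : ℕ) :
    dist (RiemannianError.flow hFc (k * h) (u 0)) (u k) ≤
      C / L * (Real.exp (k * h * L) - 1) * h ^ p := by
  have : CompleteSpace E := FiniteDimensional.complete ℝ E
  have hC : 0 ≤ C := nonneg_of_mul_nonneg_left (dist_nonneg.trans (hψ (u 0))) (by positivity)
  refine RiemannianError.le_of_forall_succ_le_exp_mul_add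
    (e := fun k ↦ dist (RiemannianError.flow hFc (k * h) (u 0)) (u k)) hC hL hh.le
    (by simp [RiemannianError.flow_zero]) (fun k ↦ ?_) k
  have hflow : RiemannianError.flow hFc ((k + 1 : ℕ) * h) (u 0) =
      RiemannianError.flow hFc h (RiemannianError.flow hFc (k * h) (u 0)) := by
    rw [← RiemannianError.flow_add hFc hF, Nat.cast_succ, add_one_mul, add_comm]
  rw [hflow, hu k]
  refine (dist_triangle _ (RiemannianError.flow hFc h (u k)) _).trans (add_le_add ?_ ?_)
  · exact RiemannianError.dist_flow_le hF hFL hFc hh.le _ _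
  · exact (dist_comm _ _).trans_le (hψ (u k))

theorem mainTheorem1
    {E : Type*} [NormedAddCommGroup E] [NormedSpace ℝ E] [FiniteDimensional ℝ E]
    {H : Type*} [TopologicalSpace H] {I : ModelWithCorners ℝ E H} [I.Boundaryless]
    {M : Type*} [MetricSpace M] [ConnectedSpace M] [ChartedSpace H M] [IsManifold I ∞ M]
    [RiemannianBundle (fun x : M ↦ TangentSpace I x)]
    [IsContMDiffRiemannianBundle I ∞ E (fun x : M ↦ TangentSpace I x)]
    [IsRiemannianManifold I M]
    (F : Π x : M, TangentSpace I x)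
    (hF : ContMDiff I I.tangent ∞ (fun x ↦ (⟨x, F x⟩ : TangentBundle I M)))
    (hFc : RiemannianError.IsCompleteVectorField F)
    (L : ℝ) (hL : 0 < L) (hFL : ∀ x : M, ‖RiemannianError.leviCivita I M F x‖ ≤ L)
    (ψ : ℝ → M → M) (C : ℝ) (p : ℕ) :
    ∀ h : ℝ, 0 < h →
      (∀ u : M, dist (ψ h u) (RiemannianError.flow hFc h u) ≤ C * h ^ (p + 1)) →
      ∀ u : ℕ → M, (∀ k, u (k + 1) = ψ h (u k)) →
        ∀ k : ℕ, 0 < k →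
          dist (RiemannianError.flow hFc (k * h) (u 0)) (u k) ≤
            C / L * (Real.exp (k * h * L) - 1) * h ^ p :=
  fun _ hh hψ _ hu k _ ↦ mainTheorem1_general (hF.of_le (by simp)) hFc hL
    (fun x v ↦ RiemannianError.inner_apply_self_le_of_norm_le (hFL x) v) hh hψ hu k
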